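/- Let $N\ge 0$ be an integer and let $\mathbf X=(X_1,\dots,X_N)$ be an $N$-dimensional Gaussian random vector (its covariance matrix may be singular) with mean vector $\boldsymbol\mu=(\mu_1,\dots,\mu_N)$, $\mu_i=\mathbb E[X_i]$, and covariance matrix $C=(C_{ij})$, $C_{ij}=\operatorname{Cov}(X_i,X_j)$. Let $\mathbf n=(n_1,\dots,n_N)$ be a vector of nonnegative integers. For an $N\times N$ matrix $\mathbf m=(m_{ij})$ of nonnegative integers put $$r_i=r_i(\mathbf n,\mathbf m)=n_i-\sum_{j=1}^N(1+\delta_{ij})\,m_{ij},\qquad i=1,\dots,N,$$ where $\delta_{ij}$ is the Kronecker delta, and let $S_{\mathbf n}$ be the (finite) set of all symmetric $N\times N$ matrices $\mathbf m$ of nonnegative integers such that $r_i\ge 0$ for all $i=1,\dots,N$. Then $\prod_{i=1}^N X_i^{n_i}$ is integrable and $$\mathbb E\left[\prod_{i=1}^N X_i^{n_i}\right]=\sum_{\mathbf m\in S_{\mathbf n}} d_{\mathbf n,\mathbf m}\left(\prod_{i=1}^N\prod_{j=i}^N C_{ij}^{\,m_{ij}}\right)\left(\prod_{i=1}^N\mu_i^{\,r_i}\right),$$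 where $$d_{\mathbf n,\mathbf m}=\frac{\prod_{i=1}^N n_i!}{2^{\sum_{i=1}^N m_{ii}}\left(\prod_{i=1}^N\prod_{j=i}^N m_{ij}!\right)\left(\prod_{i=1}^N r_i!\right)},$$ with the convention $0^0=1$. -/

import Mathlib

open MeasureTheory ProbabilityTheory

namespace GaussianMoments

/-- The integer `r_i = n_i - ∑_j (1 + δ_ij) m_ij` (no truncated subtraction). -/
def r {N : ℕ} (n : Fin N → ℕ) (m : Matrix (Fin N) (Fin N) ℕ) (i : Fin N) : ℤ :=
  (n i : ℤ) - ∑ j, (1 + (if i = j then 1 else 0)) * (m i j : ℤ)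

/-- The symmetric matrices `m` of nonnegative integers for which every `r_i` is nonnegative. -/
def S {N : ℕ} (n : Fin N → ℕ) : Set (Matrix (Fin N) (Fin N) ℕ) :=
  {m | m.IsSymm ∧ ∀ i, 0 ≤ r n m i}

theorem S_finite {N : ℕ} (n : Fin N → ℕ) : (S n).Finite := by
  have hfin : (Set.pi Set.univ fun i : Fin N =>
      Set.pi Set.univ fun _ : Fin N => Set.Iic (n i)).Finite :=
    Set.Finite.pi fun i => Set.Finite.pi fun _ => Set.finite_Iic (n i)
  refine hfin.subset ?_
  rintro m ⟨-, hm⟩ i - j -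
  have h1 : (m i j : ℤ) ≤ (1 + (if i = j then 1 else 0)) * (m i j : ℤ) := by
    split_ifs <;> omega
  have h2 : (1 + (if i = j then 1 else 0)) * (m i j : ℤ)
      ≤ ∑ k, (1 + (if i = k then 1 else 0)) * (m i k : ℤ) :=
    Finset.single_le_sum (f := fun k => (1 + (if i = k then 1 else 0)) * (m i k : ℤ))
      (fun k _ => by positivity) (Finset.mem_univ j)
  have h3 := hm i
  unfold r at h3
  have h4 : (m i j : ℤ) ≤ (n i : ℤ) := by linarith
  exact_mod_cast h4

/-- The coefficient
`d_{n,m} = ∏ n_i! / (2 ^ (∑ m_ii) * ∏_{i ≤ j} m_ij! * ∏ r_i!)`, as a real number.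
It is used for `m ∈ S n` only, where `(r n m i).toNat` is `r n m i` itself. -/
noncomputable def d {N : ℕ} (n : Fin N → ℕ) (m : Matrix (Fin N) (Fin N) ℕ) : ℝ :=
  (∏ i, ((n i).factorial : ℝ)) /
    ((2 : ℝ) ^ (∑ i, m i i) * (∏ i, ∏ j ∈ Finset.Ici i, ((m i j).factorial : ℝ)) *
      ∏ i, ((r n m i).toNat.factorial : ℝ))

end GaussianMoments

/-!
Polarization: the moments of a Gaussian vector are determined by the moments of its linear forms
`t ⬝ X`, which are real Gaussian variables of mean `t ⬝ μ` and variance `tᵀ C t`. The `p`-th moment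
of a real Gaussian variable is `p!` times the coefficient of `z ^ p` in `exp (m z + v z² / 2)`.
Hence `𝔼[(t ⬝ X) ^ p] / p!` is an explicit polynomial in `t`; by the multinomial theorem its
coefficient of `∏ t_i ^ n_i`, where `p = ∑ n_i`, is `𝔼[∏ X_i ^ n_i] / ∏ n_i!`.

To read off this coefficient, write `tᵀ C t / 2` as a sum over unordered pairs `{i, j}`, loops
included, of `C_ij t_i t_j`, where loops get the weight `1 / 2`. Expanding its powers gives a sum
over multigraphs `k : Sym2 ι → ℕ`, and the exponent of `t_i` contributed by `k` is the degree of
the vertex `i`. A multigraph is the same thing as a symmetric matrix of nonnegative integers, and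
`r_i` is what the degree of `i` leaves of `n_i`.
-/

namespace GaussianMoments

open Finset
open scoped Nat

section Exponential

variable (K : Type*) {A B : Type*} [Field K] [CommSemiring A] [Algebra K A] [CommSemiring B]
  [Algebra K B]

/-- The coefficient of `z ^ p` in the power series `exp (x z + y z²)`: up to the factor `p!`, the
two-variable Hermite (heat) polynomial. The subtraction does not truncate, as `b ≤ p / 2`. -/
noncomputable def expQuadCoeff (x y : A) (p : ℕ) : A :=
  ∑ b ∈ range (p / 2 + 1), ((p - 2 * b)! * b ! : K)⁻¹ • (x ^ (p - 2 * b) * y ^ b)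

theorem map_expQuadCoeff (f : A →ₐ[K] B) (x y : A) (p : ℕ) :
    f (expQuadCoeff K x y p) = expQuadCoeff K (f x) (f y) p := by
  simp only [expQuadCoeff, map_sum, map_smul, map_mul, map_pow]

variable {K} {κ : Type*} [CharZero K]

theorem inv_factorial_sum_mul_multinomial (s : Finset κ) (k : κ → ℕ) :
    ((∑ e ∈ s, k e)! : K)⁻¹ * Nat.multinomial s k = ∏ e ∈ s, ((k e)! : K)⁻¹ := by
  have hne : (Nat.multinomial s k : K) ≠ 0 := Nat.cast_ne_zero.2 (Nat.multinomial_pos s k).ne'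
  rw [← Nat.multinomial_spec, prod_inv_distrib, Nat.cast_mul, Nat.cast_prod, mul_inv,
    inv_mul_cancel_right₀ hne]

theorem inv_factorial_smul_sum_pow [DecidableEq κ] (s : Finset κ) (y : κ → A) (b : ℕ) :
    (b ! : K)⁻¹ • (∑ e ∈ s, y e) ^ b =
      ∑ k ∈ s.piAntidiag b, ∏ e ∈ s, ((k e)! : K)⁻¹ • y e ^ k e := by
  rw [sum_pow_eq_sum_piAntidiag, smul_sum]
  refine sum_congr rfl fun k hk => ?_
  rw [prod_smul, ← inv_factorial_sum_mul_multinomial, (mem_piAntidiag.1 hk).1, mul_smul,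
    Nat.cast_smul_eq_nsmul, nsmul_eq_mul]

end Exponential

section UnorderedPairs

variable {ι R : Type*} [Fintype ι] [DecidableEq ι]

theorem sum_count_toMultiset_mul [NonAssocSemiring R] (F : Sym2 ι → R) (i : ι) :
    ∑ e : Sym2 ι, e.toMultiset.count i * F e =
      ∑ j, (1 + if i = j then 1 else 0) * F s(i, j) := by
  refine (sum_of_injOn (fun j => s(i, j)) (fun j _ l _ h => Sym2.congr_right.1 h)
    (fun _ _ => mem_univ _) (fun e _ he => ?_) fun j _ => ?_).symm
  · have hi : i ∉ e := fun ⟨j, hj⟩ => he ⟨j, mem_univ j, hj.symm⟩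
    rw [Multiset.count_eq_zero_of_notMem (mt Sym2.mem_toMultiset.1 hi), Nat.cast_zero, zero_mul]
  · simp [Sym2.toMultiset, List.count_singleton, eq_comm (a := i), add_comm]

theorem sum_sum_eq_two_mul_sum_sym2 [NonAssocSemiring R] (F : Sym2 ι → R) :
    ∑ i, ∑ j, (1 + if i = j then 1 else 0) * F s(i, j) = 2 * ∑ e, F e := by
  simp only [← sum_count_toMultiset_mul]
  rw [sum_comm, mul_sum]
  refine sum_congr rfl fun e _ => ?_
  rw [← sum_mul, ← Nat.cast_sum, Multiset.sum_count_eq_card fun _ _ => mem_univ _,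
    Sym2.card_toMultiset, Nat.cast_ofNat]

/-- The degree sequence of the multigraph on `ι` in which the unordered pair `e` is an edge of
multiplicity `k e`; a loop counts twice. It is bundled as a `Finsupp` to serve as the exponent of a
monomial. -/
noncomputable def degree (k : Sym2 ι → ℕ) : ι →₀ ℕ :=
  ∑ e, k e • Multiset.toFinsupp e.toMultiset

theorem degree_apply (k : Sym2 ι → ℕ) (i : ι) :
    degree k i = ∑ j, (1 + if i = j then 1 else 0) * k s(i, j) := by
  simp [degree, ← sum_count_toMultiset_mul, mul_comm]

theorem sum_degree (k : Sym2 ι → ℕ) : ∑ i, degree k i = 2 * ∑ e, k e := by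
  simp only [degree_apply]
  exact sum_sum_eq_two_mul_sum_sym2 k

theorem two_mul_sum_le_of_degree_le {n : ι →₀ ℕ} {k : Sym2 ι → ℕ} (h : degree k ≤ n) :
    2 * ∑ e, k e ≤ ∑ i, n i :=
  (sum_degree k).symm.trans_le (sum_le_sum fun i _ => h i)

/-- The multigraphs on `ι` whose degree sequence is at most `n`. The bound on the multiplicities
only serves to have a finite set to filter, see `mem_degreeLE`. -/
noncomputable def degreeLE (n : ι →₀ ℕ) : Finset (Sym2 ι → ℕ) :=
  {k ∈ Iic fun _ => ∑ i, n i | degree k ≤ n}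

theorem mem_degreeLE {n : ι →₀ ℕ} {k : Sym2 ι → ℕ} : k ∈ degreeLE n ↔ degree k ≤ n := by
  refine mem_filter.trans (and_iff_right_of_imp fun h => mem_Iic.2 fun e => ?_)
  have hsum := two_mul_sum_le_of_degree_le h
  exact (single_le_sum (fun e _ => (k e).zero_le) (mem_univ e)).trans (by omega)

theorem prod_sym2_eq_prod_prod_Ici {α M : Type*} [Fintype α] [LinearOrder α]
    [LocallyFiniteOrderTop α] [CommMonoid M] (F : Sym2 α → M) :
    ∏ e, F e = ∏ i, ∏ j ∈ Ici i, F s(i, j) := by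
  rw [← Sym2.sortEquiv.symm.prod_comp, prod_sigma']
  refine prod_bij' (fun p _ => ⟨p.1.1, p.1.2⟩) (fun x hx => ⟨(x.1, x.2), by simpa using hx⟩)
    ?_ ?_ ?_ ?_ ?_ <;> simp

end UnorderedPairs

section Polynomial

open MvPolynomial

variable {ι R K : Type*}

theorem sym2_mul_map_X [DecidableEq ι] [CommSemiring R] (e : Sym2 ι) :
    (e.map X).mul = monomial (R := R) (Multiset.toFinsupp e.toMultiset) 1 := by
  induction e with | _ i j
  have hij : s(i, j).toMultiset = {i} + {j} := rfl
  rw [hij, map_add, Multiset.toFinsupp_singleton, Multiset.toFinsupp_singleton, Sym2.map_mk,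
    Sym2.mul_mk, X, X, monomial_mul, one_mul]

theorem eval_sym2_mul_map_X [CommSemiring R] (t : ι → R) (e : Sym2 ι) :
    eval t (e.map X).mul = (e.map t).mul := by
  induction e with | _ i j
  simp

variable [Fintype ι]

theorem eq_coeff_of_forall_sum_mul_prod_pow_eq_eval [DecidableEq ι] [CommRing R] [IsDomain R]
    [Infinite R] {n : ι →₀ ℕ} {c : (ι → ℕ) → R} {Q : MvPolynomial ι R}
    (h : ∀ t : ι → R, ∑ k ∈ univ.piAntidiag (∑ i, n i), c k * ∏ i, t i ^ k i = eval t Q) :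
    c n = coeff n Q := by
  have hQ : ∑ k ∈ univ.piAntidiag (∑ i, n i),
      monomial (Finsupp.equivFunOnFinite.symm k) (c k) = Q := by
    refine MvPolynomial.funext fun t => ?_
    simpa [eval_monomial, Finsupp.prod_fintype] using h t
  rw [← hQ, coeff_sum, sum_eq_single_of_mem ⇑n (by simp)]
  · simp [coeff_monomial]
  · intro k _ hk
    rw [coeff_monomial, if_neg fun h => hk (by rw [← h]; rfl)]

variable [Field K] [CharZero K]

theorem coeff_inv_factorial_smul_sum_smul_X_pow (μ : ι → K) (s : ι →₀ ℕ) :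
    coeff s (((∑ i, s i)! : K)⁻¹ • (∑ i, μ i • X i) ^ (∑ i, s i)) =
      ∏ i, μ i ^ s i / (s i)! := by
  rw [coeff_smul, coeff_linearCombination_X_pow_of_fintype,
    if_pos (s.sum_fintype _ fun _ => rfl), s.prod_fintype _ fun _ => pow_zero _,
    Finsupp.multinomial_eq_of_support_subset (subset_univ _), smul_eq_mul, ← mul_assoc,
    inv_factorial_sum_mul_multinomial, ← prod_mul_distrib]
  simp only [div_eq_inv_mul]

variable [DecidableEq ι]

theorem inv_factorial_smul_sum_smul_sym2_mul_pow (q : Sym2 ι → K) (b : ℕ) :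
    (b ! : K)⁻¹ • (∑ e : Sym2 ι, q e • (e.map (X (R := K))).mul) ^ b =
      ∑ k ∈ univ.piAntidiag b, monomial (degree k) (∏ e, q e ^ k e / (k e)!) := by
  rw [inv_factorial_smul_sum_pow]
  refine sum_congr rfl fun k _ => ?_
  rw [degree, monomial_sum_prod]
  refine prod_congr rfl fun e _ => ?_
  simp only [sym2_mul_map_X, smul_monomial, monomial_pow, smul_eq_mul, mul_one, div_eq_inv_mul]

theorem coeff_expQuadCoeff (μ : ι → K) (q : Sym2 ι → K) (n : ι →₀ ℕ) :
    coeff n (expQuadCoeff K (∑ i, μ i • X i) (∑ e, q e • (e.map X).mul) (∑ i, n i)) =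
      ∑ k ∈ degreeLE n, (∏ i, μ i ^ (n i - degree k i) / (n i - degree k i)!) *
        ∏ e, q e ^ k e / (k e)! := by
  have hedges : ∀ k ∈ degreeLE n, ∑ e, k e ∈ range ((∑ i, n i) / 2 + 1) := fun k hk => by
    have hsum := two_mul_sum_le_of_degree_le (mem_degreeLE.1 hk)
    rw [mem_range]
    omega
  rw [expQuadCoeff, coeff_sum, ← sum_fiberwise_of_maps_to hedges]
  refine sum_congr rfl fun b _ => ?_
  rw [mul_inv, ← smul_mul_smul_comm, inv_factorial_smul_sum_smul_sym2_mul_pow, mul_sum, coeff_sum]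
  simp only [coeff_mul_monomial']
  rw [← sum_filter]
  refine sum_congr ?_ fun k hk => ?_
  · ext k
    simp [mem_degreeLE, and_comm]
  · obtain ⟨hdeg, hb⟩ : degree k ≤ n ∧ ∑ e, k e = b := by simpa [mem_degreeLE] using hk
    have hsum : ∑ i, n i - 2 * b = ∑ i, (n - degree k) i := by
      simp only [Finsupp.tsub_apply]
      rw [sum_tsub_distrib _ fun i _ => hdeg i, sum_degree, hb]
    rw [hsum, coeff_inv_factorial_smul_sum_smul_X_pow]
    simp only [Finsupp.tsub_apply]

end Polynomial

section GaussianReal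

theorem sum_range_succ_eq_sum_even {M : Type*} [AddCommMonoid M] {F : ℕ → M}
    (hF : ∀ b, F (2 * b + 1) = 0) (p : ℕ) :
    ∑ k ∈ range (p + 1), F k = ∑ b ∈ range (p / 2 + 1), F (2 * b) := by
  refine (sum_of_injOn (2 * ·) (fun a _ b _ h => by simpa using h)
    (fun b hb => ?_) (fun k hk hk' => ?_) fun _ _ => rfl).symm
  · simp only [coe_range, Set.mem_Iio] at hb ⊢
    omega
  · obtain ⟨b, rfl | rfl⟩ := k.even_or_odd'
    · refine absurd ⟨b, ?_, rfl⟩ hk'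
      simp only [mem_range, coe_range, Set.mem_Iio] at hk ⊢
      omega
    · exact hF b

theorem iteratedDeriv_succ_id_mul_zero {𝕜 : Type*} [NontriviallyNormedField 𝕜] {g : 𝕜 → 𝕜} {k : ℕ}
    (hg : ContDiffAt 𝕜 (k + 1) g 0) :
    iteratedDeriv (k + 1) (fun t => t * g t) 0 = (k + 1) * iteratedDeriv k g 0 := by
  rw [iteratedDeriv_fun_mul contDiffAt_id (by exact_mod_cast hg), sum_eq_single_of_mem 1 (by simp)]
  · simp [iteratedDeriv_fun_id_zero]
  · intro i _ hi
    simp [iteratedDeriv_fun_id_zero, hi]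

theorem deriv_exp_mul_sq (w : ℝ) :
    deriv (fun t => Real.exp (w * t ^ 2)) = fun t => t * (2 * w * Real.exp (w * t ^ 2)) := by
  ext t
  rw [deriv_exp (by fun_prop), deriv_const_mul_field, deriv_pow_field]
  push_cast
  ring

theorem iteratedDeriv_add_two_exp_mul_sq_zero (w : ℝ) (k : ℕ) :
    iteratedDeriv (k + 2) (fun t => Real.exp (w * t ^ 2)) 0 =
      (k + 1) * (2 * w) * iteratedDeriv k (fun t => Real.exp (w * t ^ 2)) 0 := by
  rw [iteratedDeriv_succ', deriv_exp_mul_sq, iteratedDeriv_succ_id_mul_zero (by fun_prop),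
    iteratedDeriv_const_mul_field, ← mul_assoc, ← mul_assoc]

theorem iteratedDeriv_odd_exp_mul_sq_zero (w : ℝ) (b : ℕ) :
    iteratedDeriv (2 * b + 1) (fun t => Real.exp (w * t ^ 2)) 0 = 0 := by
  induction b with
  | zero => simp [iteratedDeriv_one, deriv_exp_mul_sq]
  | succ b ih =>
    rw [mul_add_one, add_right_comm, iteratedDeriv_add_two_exp_mul_sq_zero, ih, mul_zero]

theorem iteratedDeriv_even_exp_mul_sq_zero (w : ℝ) (b : ℕ) :
    iteratedDeriv (2 * b) (fun t => Real.exp (w * t ^ 2)) 0 = (2 * b)! / b ! * w ^ b := by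
  induction b with
  | zero => simp
  | succ b ih =>
    rw [mul_add_one, iteratedDeriv_add_two_exp_mul_sq_zero, ih]
    simp only [Nat.factorial_succ]
    push_cast
    field_simp
    ring

theorem iteratedDeriv_exp_mul_add_mul_sq_zero (m w : ℝ) (p : ℕ) :
    iteratedDeriv p (fun t => Real.exp (m * t + w * t ^ 2)) 0 = p ! * expQuadCoeff ℝ m w p := by
  have hleibniz : iteratedDeriv p (fun t => Real.exp (m * t + w * t ^ 2)) 0 =
      ∑ k ∈ range (p + 1), p.choose k * iteratedDeriv k (fun t => Real.exp (w * t ^ 2)) 0 *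
        m ^ (p - k) := by
    simp only [add_comm (m * _), Real.exp_add]
    rw [iteratedDeriv_fun_mul (by fun_prop) (by fun_prop)]
    simp
  rw [hleibniz, sum_range_succ_eq_sum_even (by simp [iteratedDeriv_odd_exp_mul_sq_zero]),
    expQuadCoeff, mul_sum]
  refine sum_congr rfl fun b hb => ?_
  have hle : 2 * b ≤ p := by
    rw [mem_range] at hb
    omega
  rw [iteratedDeriv_even_exp_mul_sq_zero, Nat.cast_choose ℝ hle, smul_eq_mul]
  field_simp

theorem integral_pow_gaussianReal (m : ℝ) (v : NNReal) (p : ℕ) :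
    ∫ x, x ^ p ∂gaussianReal m v = p ! * expQuadCoeff ℝ m (v / 2) p := by
  rw [← iteratedDeriv_exp_mul_add_mul_sq_zero]
  simp only [div_mul_eq_mul_div]
  rw [← mgf_id_gaussianReal, iteratedDeriv_mgf_zero (by simp)]
  rfl

end GaussianReal

section GaussianVector

variable {ι Ω : Type*} {mΩ : MeasurableSpace Ω} {P : Measure Ω} {X : Ω → ι → ℝ}

theorem integral_pow_of_hasGaussianLaw {Y : Ω → ℝ} (hY : HasGaussianLaw Y P) (p : ℕ) :
    ∫ ω, Y ω ^ p ∂P = p ! * expQuadCoeff ℝ (∫ ω, Y ω ∂P) (Var[Y; P] / 2) p := by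
  rw [← Real.coe_toNNReal _ (variance_nonneg Y P), ← integral_pow_gaussianReal,
    ← hY.map_eq_gaussianReal, integral_map hY.aemeasurable (by fun_prop)]

/-- The coefficient of `t_i t_j` in half the variance of the linear form `∑ i, t i * X i`, as a
function of the unordered pair `s(i, j)`. -/
noncomputable def covWeight [DecidableEq ι] (X : Ω → ι → ℝ) (P : Measure Ω) : Sym2 ι → ℝ :=
  Sym2.lift ⟨fun i j => cov[fun ω => X ω i, fun ω => X ω j; P] / (1 + if i = j then 1 else 0),
    fun i j => by simp only [covariance_comm (fun ω => X ω i), eq_comm (a := i)]⟩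

theorem covWeight_mk [DecidableEq ι] (i j : ι) : covWeight X P s(i, j) =
    cov[fun ω => X ω i, fun ω => X ω j; P] / (1 + if i = j then 1 else 0) :=
  rfl

variable [Fintype ι]

theorem integrable_prod_pow (hX : HasGaussianLaw X P) (n : ι → ℕ) :
    Integrable (fun ω => ∏ i, X ω i ^ n i) P := by
  have := hX.isProbabilityMeasure
  have hnorm : Integrable (fun ω => ‖X ω‖ ^ ∑ i, n i) P :=
    (hX.memLp (p := (∑ i, n i : ℕ)) (by simp)).integrable_norm_pow'
  have hmeas : AEMeasurable X P := hX.aemeasurable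
  refine hnorm.mono' (AEMeasurable.aestronglyMeasurable (by fun_prop)) (.of_forall fun ω => ?_)
  rw [norm_prod, ← prod_pow_eq_pow_sum]
  refine prod_le_prod (fun i _ => norm_nonneg _) fun i _ => ?_
  rw [norm_pow]
  gcongr
  exact norm_le_pi_norm (X ω) i

theorem hasGaussianLaw_sum_mul (hX : HasGaussianLaw X P) (t : ι → ℝ) :
    HasGaussianLaw (fun ω => ∑ i, t i * X ω i) P := by
  simpa using hX.map_fun (∑ i, t i • (ContinuousLinearMap.proj i : (ι → ℝ) →L[ℝ] ℝ))

theorem integral_sum_mul (hX : HasGaussianLaw X P) (t : ι → ℝ) :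
    ∫ ω, ∑ i, t i * X ω i ∂P = ∑ i, t i * ∫ ω, X ω i ∂P := by
  have := hX.isProbabilityMeasure
  rw [integral_finsetSum _ fun i _ => (hX.eval i).integrable.const_mul (t i)]
  simp only [integral_const_mul]

variable [DecidableEq ι]

theorem variance_sum_mul_div_two (hX : HasGaussianLaw X P) (t : ι → ℝ) :
    Var[fun ω => ∑ i, t i * X ω i; P] / 2 = ∑ e, covWeight X P e * (e.map t).mul := by
  have := hX.isProbabilityMeasure
  have hmem (i : ι) : MemLp (fun ω => t i * X ω i) 2 P := (hX.eval i).memLp_two.const_mul (t i)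
  rw [div_eq_iff two_ne_zero, mul_comm _ (2 : ℝ), ← sum_sum_eq_two_mul_sum_sym2,
    ← covariance_self (hasGaussianLaw_sum_mul hX t).aemeasurable,
    covariance_fun_sum_fun_sum hmem hmem]
  refine sum_congr rfl fun i _ => sum_congr rfl fun j _ => ?_
  have hne : (1 + if i = j then 1 else 0 : ℝ) ≠ 0 := by positivity
  rw [covariance_const_mul_left, covariance_const_mul_right, covWeight_mk, Sym2.map_mk,
    Sym2.mul_mk]
  field_simp

theorem integral_sum_mul_pow (hX : HasGaussianLaw X P) (t : ι → ℝ) (p : ℕ) :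
    ∫ ω, (∑ i, t i * X ω i) ^ p ∂P = p ! * ∑ k ∈ univ.piAntidiag p,
      (∫ ω, ∏ i, X ω i ^ k i ∂P) / (∏ i, ((k i)! : ℝ)) * ∏ i, t i ^ k i := by
  have hexpand (ω : Ω) : (∑ i, t i * X ω i) ^ p = p ! * ∑ k ∈ univ.piAntidiag p,
      (∏ i, X ω i ^ k i) * ((∏ i, t i ^ k i) / ∏ i, ((k i)! : ℝ)) := by
    rw [← inv_mul_eq_iff_eq_mul₀ (by positivity), ← smul_eq_mul, inv_factorial_smul_sum_pow]
    refine sum_congr rfl fun k _ => ?_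
    simp only [smul_eq_mul, mul_pow, prod_mul_distrib, prod_inv_distrib]
    ring
  simp only [hexpand]
  rw [integral_const_mul, integral_finsetSum _ fun k _ => (integrable_prod_pow hX k).mul_const _]
  simp only [integral_mul_const, div_mul_eq_mul_div, mul_div_assoc]

theorem sum_integral_prod_pow_eq_eval_expQuadCoeff (hX : HasGaussianLaw X P) (t : ι → ℝ) (p : ℕ) :
    ∑ k ∈ univ.piAntidiag p,
        (∫ ω, ∏ i, X ω i ^ k i ∂P) / (∏ i, ((k i)! : ℝ)) * ∏ i, t i ^ k i =
      MvPolynomial.eval t (expQuadCoeff ℝ (∑ i, (∫ ω, X ω i ∂P) • MvPolynomial.X i)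
        (∑ e, covWeight X P e • (e.map MvPolynomial.X).mul) p) := by
  have hp : (p ! : ℝ) ≠ 0 := by positivity
  rw [← mul_right_inj' hp, ← integral_sum_mul_pow hX,
    integral_pow_of_hasGaussianLaw (hasGaussianLaw_sum_mul hX t), integral_sum_mul hX,
    variance_sum_mul_div_two hX, ← MvPolynomial.coe_aeval_eq_eval, RingHom.coe_coe,
    map_expQuadCoeff]
  simp [eval_sym2_mul_map_X, MvPolynomial.aeval_eq_eval, mul_comm]

theorem integral_prod_pow_eq_sum_degreeLE (hX : HasGaussianLaw X P) (n : ι →₀ ℕ) :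
    ∫ ω, ∏ i, X ω i ^ n i ∂P = (∏ i, ((n i)! : ℝ)) * ∑ k ∈ degreeLE n,
      (∏ i, (∫ ω, X ω i ∂P) ^ (n i - degree k i) / (n i - degree k i)!) *
        ∏ e, covWeight X P e ^ k e / (k e)! := by
  rw [← coeff_expQuadCoeff, ← eq_coeff_of_forall_sum_mul_prod_pow_eq_eval
    (sum_integral_prod_pow_eq_eval_expQuadCoeff hX · _), mul_div_cancel₀]
  positivity

end GaussianVector

section SymmetricMatrix

/-- The symmetric matrix of a function on unordered pairs, that is, the matrix of multiplicities of
a multigraph. Its diagonal counts each loop once, although `degree` counts it twice. -/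
def adjMatrix {ι α : Type*} (k : Sym2 ι → α) : Matrix ι ι α :=
  .of fun i j => k s(i, j)

theorem adjMatrix_apply {ι α : Type*} (k : Sym2 ι → α) (i j : ι) : adjMatrix k i j = k s(i, j) :=
  rfl

theorem adjMatrix_injective {ι α : Type*} :
    Function.Injective (adjMatrix : (Sym2 ι → α) → Matrix ι ι α) := fun k l h => by
  ext e
  induction e with | _ i j
  exact congrFun₂ h i j

theorem exists_adjMatrix_eq_iff {ι α : Type*} {m : Matrix ι ι α} :
    (∃ k, adjMatrix k = m) ↔ m.IsSymm := by
  refine ⟨?_, fun hm => ⟨Sym2.lift ⟨m, fun i j => hm.apply j i⟩, rfl⟩⟩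
  rintro ⟨k, rfl⟩
  exact .ext fun i j => congrArg k Sym2.eq_swap

theorem prod_prod_Ici_one_add_ite_pow {ι R : Type*} [Fintype ι] [LinearOrder ι]
    [LocallyFiniteOrderTop ι] [CommSemiring R] (m : Matrix ι ι ℕ) :
    ∏ i, ∏ j ∈ Ici i, (1 + if i = j then 1 else 0 : R) ^ m i j = 2 ^ ∑ i, m i i := by
  rw [← prod_pow_eq_pow_sum]
  refine prod_congr rfl fun i _ => ?_
  rw [prod_eq_single_of_mem i (by simp) fun j _ hj => by simp [hj.symm], if_pos rfl,
    one_add_one_eq_two]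

variable {N : ℕ}

theorem r_adjMatrix (n : Fin N → ℕ) (k : Sym2 (Fin N) → ℕ) (i : Fin N) :
    r n (adjMatrix k) i = n i - degree k i := by
  simp [r, adjMatrix_apply, degree_apply]

theorem toFinset_S (n : Fin N →₀ ℕ) :
    (S_finite n).toFinset = (degreeLE n).map ⟨adjMatrix, adjMatrix_injective⟩ := by
  ext m
  simp only [Set.Finite.mem_toFinset, S, Set.mem_ofPred_eq, ← exists_adjMatrix_eq_iff, mem_map,
    mem_degreeLE, Function.Embedding.coeFn_mk]
  constructor
  · rintro ⟨⟨k, rfl⟩, hr⟩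
    exact ⟨k, fun i => by simpa [r_adjMatrix] using hr i, rfl⟩
  · rintro ⟨k, hk, rfl⟩
    exact ⟨⟨k, rfl⟩, fun i => by simpa [r_adjMatrix] using hk i⟩

theorem d_mul_prod_adjMatrix (n : Fin N → ℕ) (k : Sym2 (Fin N) → ℕ) (μ : Fin N → ℝ)
    {C : Matrix (Fin N) (Fin N) ℝ} {q : Sym2 (Fin N) → ℝ}
    (hq : ∀ i j, q s(i, j) = C i j / (1 + if i = j then 1 else 0)) :
    d n (adjMatrix k) * (∏ i, ∏ j ∈ Ici i, C i j ^ adjMatrix k i j) *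
        ∏ i, μ i ^ (r n (adjMatrix k) i).toNat =
      (∏ i, ((n i)! : ℝ)) * ((∏ i, μ i ^ (n i - degree k i) / (n i - degree k i)!) *
        ∏ e, q e ^ k e / (k e)!) := by
  have hr (i : Fin N) : (r n (adjMatrix k) i).toNat = n i - degree k i := by
    rw [r_adjMatrix, Int.toNat_sub]
  rw [d, ← prod_prod_Ici_one_add_ite_pow, prod_sym2_eq_prod_prod_Ici]
  simp only [hr, adjMatrix_apply, hq, prod_div_distrib, div_pow]
  ring

end SymmetricMatrix

end GaussianMoments

theorem mainTheorem3 {Ω : Type*} [MeasurableSpace Ω] (P : Measure Ω) {N : ℕ}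
    (X : Ω → Fin N → ℝ) (hX : HasGaussianLaw X P)
    (μ : Fin N → ℝ) (hμ : ∀ i, μ i = ∫ ω, X ω i ∂P)
    (C : Matrix (Fin N) (Fin N) ℝ)
    (hC : ∀ i j, C i j = cov[fun ω => X ω i, fun ω => X ω j; P])
    (n : Fin N → ℕ) :
    Integrable (fun ω => ∏ i, X ω i ^ n i) P ∧
      ∫ ω, ∏ i, X ω i ^ n i ∂P =
        ∑ m ∈ (GaussianMoments.S_finite n).toFinset,
          GaussianMoments.d n m * (∏ i, ∏ j ∈ Finset.Ici i, C i j ^ m i j) *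
            ∏ i, μ i ^ (GaussianMoments.r n m i).toNat := by
  lift n to Fin N →₀ ℕ using Set.toFinite _
  refine ⟨GaussianMoments.integrable_prod_pow hX n, ?_⟩
  rw [GaussianMoments.integral_prod_pow_eq_sum_degreeLE hX, GaussianMoments.toFinset_S,
    Finset.sum_map, Finset.mul_sum]
  simp only [← hμ]
  refine Finset.sum_congr rfl fun k _ => ?_
  have hcov (i j : Fin N) : GaussianMoments.covWeight X P s(i, j) =
      C i j / (1 + if i = j then 1 else 0) := by
    rw [hC, GaussianMoments.covWeight_mk]
  exact (GaussianMoments.d_mul_prod_adjMatrix n k μ hcov).symm
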